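/- Let $k$ be an algebraically closed field and let $\Lambda$ be the Kronecker algebra, i.e. the path algebra over $k$ of the quiver with two vertices $0,1$ and two arrows $a,b\colon 0\to 1$; left $\Lambda$-modules are identified with representations $V\rightrightarrows W$ of this quiver. For $\lambda\in k$ let $S_\lambda$ be the simple regular module $k\rightrightarrows k$ with maps $1,\lambda$ (at $a,b$ respectively), and let $S_\infty$ be the simple regular module $k\rightrightarrows k$ with maps $0,1$. Let $I\subseteq k$ be an infinite subset, let $V(I)\subseteq k(T)$ be the $k$-subspace with basis $\{\frac1{T-\lambda}\mid\lambda\in I\}$, and let $B=P(I)$ be the module $V(I)\rightrightarrows V(I)+k\cdot 1$ whose two maps are the inclusion and the multiplication by $T$. Let $\mathcal T=\{X\in\Lambda\text{-Mod}\mid \operatorname{Hom}_\Lambda(X,B)=0\}$ and $\mathcal F=\{Y\in\Lambda\text{-Mod}\mid \operatorname{Hom}_\Lambda(X,Y)=0\text{ for all }X\in\mathcal T\}$, so that $(\mathcal T,\mathcal F)$ is the torsion pair in $\Lambda\text{-Mod}$ cogenerated by $B$, and let $$\alpha(\mathcal T)=\{X\in\mathcal T\mid \ker f\in\mathcal T\text{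 for every }f\colon Y\to X\text{ with }Y\in\mathcal T\}.$$ Then: 1. $\operatorname{Hom}_\Lambda(B,S_\lambda)\neq 0$ for all $\lambda\in k\cup\{\infty\}$. 2. $\alpha(\mathcal T)={}^{\perp_{0,1}}B=\{X\in\Lambda\text{-Mod}\mid \operatorname{Hom}_\Lambda(X,B)=0=\operatorname{Ext}^1_\Lambda(X,B)\}$, and this class contains no nonzero finite-dimensional module. -/

import Mathlib

open CategoryTheory

universe u v w

/-! ### Torsion pairs and perpendicular categories -/

/-- `(T, F)` is a torsion pair in the abelian category `A`. -/
structure IsTorsionPair {A : Type u} [Category.{v} A] [Abelian A] (T F : ObjectProperty A) :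
    Prop where
  hom_eq_zero : ∀ ⦃X Y : A⦄ (f : X ⟶ Y), T X → F Y → f = 0
  exists_shortExact : ∀ M : A, ∃ (X Y : A) (i : X ⟶ M) (p : M ⟶ Y) (h : i ≫ p = 0),
    (ShortComplex.mk i p h).ShortExact ∧ T X ∧ F Y

/-- The torsion class `{X | Hom (X, C) = 0 for all C in P}` of the torsion pair cogenerated
by the class `P`. -/
def cogeneratedTorsionClass {A : Type u} [Category.{v} A] [Abelian A] (P : ObjectProperty A) :
    ObjectProperty A :=
  P.leftOrthogonal

/-- The torsionfree class of the torsion pair cogenerated by the class `P`. -/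
def cogeneratedTorsionfreeClass {A : Type u} [Category.{v} A] [Abelian A]
    (P : ObjectProperty A) : ObjectProperty A :=
  P.leftOrthogonal.rightOrthogonal

/-- `α(T)`: the objects `X` of `T` such that every morphism `f : Y ⟶ X` with `Y` in `T` has its
kernel in `T`. -/
def alphaClass {A : Type u} [Category.{v} A] [Abelian A] (T : ObjectProperty A) :
    ObjectProperty A :=
  fun X => T X ∧ ∀ ⦃Y : A⦄ (f : Y ⟶ X), T Y → T (Limits.kernel f)

/-- The left perpendicular category: the objects `X` with `Ext⁰ (X, S) = Ext¹ (X, S) = 0`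
for all `S` in `P`. -/
def leftPerpendicular {A : Type u} [Category.{v} A] [Abelian A] [HasExt.{w} A]
    (P : ObjectProperty A) : ObjectProperty A :=
  fun X => ∀ ⦃S : A⦄, P S →
    Subsingleton (Abelian.Ext X S 0) ∧ Subsingleton (Abelian.Ext X S 1)

/-! ### The Kronecker algebra -/

/-- The path algebra of the Kronecker quiver, with two vertices `0`, `1` and two arrows
`a, b : 0 → 1`. The element `⟨s, t, x, y⟩` is `s e₀ + t e₁ + x a + y b`. Paths are composed like
maps, so that `a = e₁ a e₀`, `b = e₁ b e₀`, and left modules are representations of the quiver. -/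
@[ext]
structure KroneckerAlgebra (k : Type u) : Type u where
  e₀ : k
  e₁ : k
  a : k
  b : k

namespace KroneckerAlgebra

variable {k : Type u} [Field k]

instance : Zero (KroneckerAlgebra k) := ⟨⟨0, 0, 0, 0⟩⟩
instance : One (KroneckerAlgebra k) := ⟨⟨1, 1, 0, 0⟩⟩
instance : Add (KroneckerAlgebra k) :=
  ⟨fun x y => ⟨x.e₀ + y.e₀, x.e₁ + y.e₁, x.a + y.a, x.b + y.b⟩⟩
instance : Neg (KroneckerAlgebra k) := ⟨fun x => ⟨-x.e₀, -x.e₁, -x.a, -x.b⟩⟩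
instance : Mul (KroneckerAlgebra k) :=
  ⟨fun x y => ⟨x.e₀ * y.e₀, x.e₁ * y.e₁, x.e₁ * y.a + x.a * y.e₀, x.e₁ * y.b + x.b * y.e₀⟩⟩

@[simp] theorem zero_e₀ : (0 : KroneckerAlgebra k).e₀ = 0 := rfl
@[simp] theorem zero_e₁ : (0 : KroneckerAlgebra k).e₁ = 0 := rfl
@[simp] theorem zero_a : (0 : KroneckerAlgebra k).a = 0 := rfl
@[simp] theorem zero_b : (0 : KroneckerAlgebra k).b = 0 := rfl
@[simp] theorem one_e₀ : (1 : KroneckerAlgebra k).e₀ = 1 := rfl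
@[simp] theorem one_e₁ : (1 : KroneckerAlgebra k).e₁ = 1 := rfl
@[simp] theorem one_a : (1 : KroneckerAlgebra k).a = 0 := rfl
@[simp] theorem one_b : (1 : KroneckerAlgebra k).b = 0 := rfl
@[simp] theorem add_e₀ (x y : KroneckerAlgebra k) : (x + y).e₀ = x.e₀ + y.e₀ := rfl
@[simp] theorem add_e₁ (x y : KroneckerAlgebra k) : (x + y).e₁ = x.e₁ + y.e₁ := rfl
@[simp] theorem add_a (x y : KroneckerAlgebra k) : (x + y).a = x.a + y.a := rfl
@[simp] theorem add_b (x y : KroneckerAlgebra k) : (x + y).b = x.b + y.b := rfl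
@[simp] theorem neg_e₀ (x : KroneckerAlgebra k) : (-x).e₀ = -x.e₀ := rfl
@[simp] theorem neg_e₁ (x : KroneckerAlgebra k) : (-x).e₁ = -x.e₁ := rfl
@[simp] theorem neg_a (x : KroneckerAlgebra k) : (-x).a = -x.a := rfl
@[simp] theorem neg_b (x : KroneckerAlgebra k) : (-x).b = -x.b := rfl
@[simp] theorem mul_e₀ (x y : KroneckerAlgebra k) : (x * y).e₀ = x.e₀ * y.e₀ := rfl
@[simp] theorem mul_e₁ (x y : KroneckerAlgebra k) : (x * y).e₁ = x.e₁ * y.e₁ := rfl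
@[simp] theorem mul_a (x y : KroneckerAlgebra k) :
    (x * y).a = x.e₁ * y.a + x.a * y.e₀ := rfl
@[simp] theorem mul_b (x y : KroneckerAlgebra k) :
    (x * y).b = x.e₁ * y.b + x.b * y.e₀ := rfl

instance : Ring (KroneckerAlgebra k) where
  add_assoc x y z := by ext <;> simp [add_assoc]
  zero_add x := by ext <;> simp
  add_zero x := by ext <;> simp
  add_comm x y := by ext <;> simp [add_comm]
  neg_add_cancel x := by ext <;> simp
  mul_assoc x y z := by ext <;> simp <;> ring
  one_mul x := by ext <;> simp
  mul_one x := by ext <;> simp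
  left_distrib x y z := by ext <;> simp <;> ring
  right_distrib x y z := by ext <;> simp <;> ring
  zero_mul x := by ext <;> simp
  mul_zero x := by ext <;> simp
  nsmul := nsmulRec
  zsmul := zsmulRec

/-- The scalars: `c` is sent to `c e₀ + c e₁`. -/
def scalar (k : Type u) [Field k] : k →+* KroneckerAlgebra k where
  toFun c := ⟨c, c, 0, 0⟩
  map_one' := rfl
  map_zero' := rfl
  map_mul' x y := by ext <;> simp
  map_add' x y := by ext <;> simp

instance : Algebra k (KroneckerAlgebra k) :=
  (scalar k).toAlgebra' (fun c x => by ext <;> simp [scalar, mul_comm])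

end KroneckerAlgebra

/-- The underlying space `V ⊕ W` of the module over the Kronecker algebra given by the
representation with spaces `V`, `W` at the vertices `0`, `1`, and with the linear maps
`f, g : V → W` at the arrows `a`, `b`. -/
@[nolint unusedArguments]
def RepSpace {k V W : Type u} [Field k] [AddCommGroup V] [Module k V] [AddCommGroup W]
    [Module k W] (_f _g : V →ₗ[k] W) : Type u :=
  V × W

namespace RepSpace

variable {k V W : Type u} [Field k] [AddCommGroup V] [Module k V] [AddCommGroup W] [Module k W]
  (f g : V →ₗ[k] W)

instance : AddCommGroup (RepSpace f g) := inferInstanceAs (AddCommGroup (V × W))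

instance : SMul (KroneckerAlgebra k) (RepSpace f g) :=
  ⟨fun x m => ((x.e₀ • m.1, x.e₁ • m.2 + x.a • f m.1 + x.b • g m.1) : V × W)⟩

theorem smul_def (x : KroneckerAlgebra k) (m : RepSpace f g) :
    x • m = ((x.e₀ • m.1, x.e₁ • m.2 + x.a • f m.1 + x.b • g m.1) : V × W) := rfl

theorem ext' {m n : RepSpace f g} (h₁ : m.1 = n.1) (h₂ : m.2 = n.2) : m = n :=
  Prod.ext h₁ h₂

@[simp] theorem add_fst (m n : RepSpace f g) : (m + n).1 = m.1 + n.1 := rfl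
@[simp] theorem add_snd (m n : RepSpace f g) : (m + n).2 = m.2 + n.2 := rfl
@[simp] theorem zero_fst : (0 : RepSpace f g).1 = 0 := rfl
@[simp] theorem zero_snd : (0 : RepSpace f g).2 = 0 := rfl
@[simp] theorem smul_fst (x : KroneckerAlgebra k) (m : RepSpace f g) :
    (x • m).1 = x.e₀ • m.1 := rfl
@[simp] theorem smul_snd (x : KroneckerAlgebra k) (m : RepSpace f g) :
    (x • m).2 = x.e₁ • m.2 + x.a • f m.1 + x.b • g m.1 := rfl

instance : Module (KroneckerAlgebra k) (RepSpace f g) where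
  one_smul m := by apply ext' <;> simp
  mul_smul x y m := by
    apply ext'
    · simp [mul_smul]
    · simp only [smul_fst, smul_snd, KroneckerAlgebra.mul_e₁, KroneckerAlgebra.mul_a,
        KroneckerAlgebra.mul_b, map_smul]
      module
  smul_zero x := by apply ext' <;> simp
  smul_add x m n := by
    apply ext'
    · simp
    · simp only [add_fst, add_snd, smul_snd, map_add]
      module
  add_smul x y m := by
    apply ext'
    · simp [add_smul]
    · simp only [add_snd, smul_snd, KroneckerAlgebra.add_e₁, KroneckerAlgebra.add_a,
        KroneckerAlgebra.add_b]
      module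
  zero_smul m := by apply ext' <;> simp

end RepSpace

/-- A module over the Kronecker algebra is finite-dimensional if its underlying `k`-vector space
is. -/
def IsFiniteDimensionalModule {k : Type u} [Field k] (X : ModuleCat.{u} (KroneckerAlgebra k)) :
    Prop :=
  Module.Finite k ((ModuleCat.restrictScalars (algebraMap k (KroneckerAlgebra k))).obj X)

/-! ### The simple regular modules -/

/-- The map of `S_p` at the arrow `a`: `1` if `p ∈ k`, and `0` if `p = ∞`. -/
def simpleRegularMapA {k : Type u} [Field k] (p : OnePoint k) : k →ₗ[k] k :=
  p.elim 0 (fun _ => LinearMap.id)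

/-- The map of `S_p` at the arrow `b`: the multiplication by `c` if `p = c ∈ k`, and `1` if
`p = ∞`. -/
def simpleRegularMapB {k : Type u} [Field k] (p : OnePoint k) : k →ₗ[k] k :=
  p.elim LinearMap.id (fun c => LinearMap.mulLeft k c)

/-- The simple regular module `S_p`, for `p ∈ k ∪ {∞}`: the representation `k ⇉ k` with the maps
`1, c` if `p = c ∈ k`, and with the maps `0, 1` if `p = ∞`. -/
def simpleRegular {k : Type u} [Field k] (p : OnePoint k) : ModuleCat.{u} (KroneckerAlgebra k) :=
  ModuleCat.of (KroneckerAlgebra k) (RepSpace (simpleRegularMapA p) (simpleRegularMapB p))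

/-! ### The modules `P(I)` -/

section Ringel

variable {k : Type u} [Field k]

/-- The subspace `V(I)` of `k(T)` spanned by the elements `1 / (T - c)` with `c ∈ I`. -/
noncomputable def ringelV (I : Set k) : Submodule k (RatFunc k) :=
  Submodule.span k ((fun c : k => 1 / (RatFunc.X - RatFunc.C c : RatFunc k)) '' I)

/-- The subspace `V(I) + k · 1` of `k(T)`. -/
noncomputable def ringelW (I : Set k) : Submodule k (RatFunc k) :=
  ringelV I ⊔ Submodule.span k {1}

theorem ringelV_le_ringelW (I : Set k) : ringelV I ≤ ringelW I := le_sup_left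

theorem X_mul_mem_ringelW (I : Set k) {v : RatFunc k} (hv : v ∈ ringelV I) :
    LinearMap.mulLeft k (RatFunc.X : RatFunc k) v ∈ ringelW I := by
  suffices h : ringelV I ≤ (ringelW I).comap (LinearMap.mulLeft k (RatFunc.X : RatFunc k)) from h hv
  refine Submodule.span_le.mpr ?_
  rintro _ ⟨c, hc, rfl⟩
  have hne : (RatFunc.X - RatFunc.C c : RatFunc k) ≠ 0 := by
    rw [← RatFunc.algebraMap_X, ← RatFunc.algebraMap_C, ← map_sub]
    exact RatFunc.algebraMap_ne_zero (Polynomial.X_sub_C_ne_zero c)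
  have key : LinearMap.mulLeft k (RatFunc.X : RatFunc k) (1 / (RatFunc.X - RatFunc.C c)) =
      c • (1 / (RatFunc.X - RatFunc.C c)) + 1 := by
    rw [LinearMap.mulLeft_apply, RatFunc.smul_eq_C_mul]
    field_simp
    ring
  change LinearMap.mulLeft k (RatFunc.X : RatFunc k) (1 / (RatFunc.X - RatFunc.C c)) ∈ ringelW I
  rw [key]
  exact Submodule.add_mem_sup
    (Submodule.smul_mem _ _ (Submodule.subset_span ⟨c, hc, rfl⟩))
    (Submodule.mem_span_singleton_self 1)

/-- The module `P(I)`: the subrepresentation `V(I) ⇉ V(I) + k · 1` of the generic representation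
`k(T) ⇉ k(T)`, whose two maps are the identity and the multiplication by `T`. -/
noncomputable def ringelModule (I : Set k) : ModuleCat.{u} (KroneckerAlgebra k) :=
  ModuleCat.of (KroneckerAlgebra k)
    (RepSpace (Submodule.inclusion (ringelV_le_ringelW I))
      ((LinearMap.mulLeft k (RatFunc.X : RatFunc k)).restrict
        (fun _ hv => X_mul_mem_ringelW I hv)))

end Ringel

/-! Partial fractions turn `B = P(I)` into a concrete pair of maps `f, g : V → W`: the functions `1
/ (T - c)` with `c ∈ I` form a basis of `V`, one further vector `1` completes their images to a
basis of `W`, and `g - c f` is multiplication by `T - c`. Everything about `B` is read off from this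
(`IsRingelRep`). Neither `f` nor any `g - c f` is surjective: the coefficient of `1`, the residue at
`c` or the evaluation at `c` is a functional killing the image. Such a functional is the same as a
nonzero map to a simple regular module, which proves the first claim. Moreover `End B = k`
(`endomorphism_eq_smul`).

For `X` with `Hom (X, B) = 0`, both `X ∈ α(T)` and `Ext¹ (X, B) = 0` are compared with
`CoboundarySurjective`, the vanishing of the cokernel of `Hom (X₀, V) × Hom (X₁, W) → Hom (X₀, W)²`.
If it holds, maps to `B` from the kernel of any `Y → X` extend to `Y`, so the kernel lies in `T`
when `Y` does. Conversely, let `E` be an extension of `X ∈ α(T)` by `B`. If `E` were in `T`, so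
would be `B`, the kernel of `E → X`, which is absurd. So there is a nonzero `E → B`; it is nonzero
on `B` because `Hom (X, B) = 0`, hence a nonzero scalar there, and the extension splits.

Let `X` be finite-dimensional in this class. The non-surjectivity of `f` and `g - c f`, together
with `Ext¹ (X, B) = 0`, makes `a` and every `b - c a` injective on `X₀`. If `dim X₀ < dim X₁`, a
dimension count gives a nonzero map to a finite-dimensional submodule of `B`. If the dimensions
agree, `a⁻¹ b` has an eigenvalue `c` unless `X₀ = 0`, and then `b - c a` is not injective. So `X =
0`. -/

/-! ### Idempotents and arrows of the Kronecker algebra -/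

namespace KroneckerAlgebra

variable (k : Type u) [Field k]

/-- The idempotent at the vertex `0`. -/
def idem₀ : KroneckerAlgebra k := ⟨1, 0, 0, 0⟩

/-- The idempotent at the vertex `1`. -/
def idem₁ : KroneckerAlgebra k := ⟨0, 1, 0, 0⟩

/-- The arrow `a`. -/
def arrowA : KroneckerAlgebra k := ⟨0, 0, 1, 0⟩

/-- The arrow `b`. -/
def arrowB : KroneckerAlgebra k := ⟨0, 0, 0, 1⟩

variable {k}

theorem smul_eq (c : k) (x : KroneckerAlgebra k) :
    c • x = ⟨c * x.e₀, c * x.e₁, c * x.a, c * x.b⟩ := by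
  rw [Algebra.smul_def]
  change (⟨c, c, 0, 0⟩ : KroneckerAlgebra k) * x = _
  ext <;> simp

theorem algebraMap_eq (c : k) : algebraMap k (KroneckerAlgebra k) c = ⟨c, c, 0, 0⟩ := rfl

theorem idem₀_mul (x : KroneckerAlgebra k) : idem₀ k * x = x.e₀ • idem₀ k := by
  ext <;> simp [idem₀, smul_eq]

theorem idem₁_mul (x : KroneckerAlgebra k) :
    idem₁ k * x = x.e₁ • idem₁ k + x.a • arrowA k + x.b • arrowB k := by
  ext <;> simp [idem₁, arrowA, arrowB, smul_eq]

theorem arrowA_mul_idem₀ : arrowA k * idem₀ k = arrowA k := by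
  ext <;> simp [idem₀, arrowA]

theorem arrowB_mul_idem₀ : arrowB k * idem₀ k = arrowB k := by
  ext <;> simp [idem₀, arrowB]

theorem idem₁_mul_arrowA : idem₁ k * arrowA k = arrowA k := by
  ext <;> simp [idem₁, arrowA]

theorem idem₁_mul_arrowB : idem₁ k * arrowB k = arrowB k := by
  ext <;> simp [idem₁, arrowB]

theorem idem₀_add_idem₁ : idem₀ k + idem₁ k = 1 := by
  ext <;> simp [idem₀, idem₁]

section Module

variable {M : Type v} [AddCommGroup M] [Module (KroneckerAlgebra k) M]

theorem idem₀_smul_idem₀_smul (m : M) : idem₀ k • idem₀ k • m = idem₀ k • m := by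
  rw [← mul_smul]; congr 1; ext <;> simp [idem₀]

theorem idem₁_smul_idem₁_smul (m : M) : idem₁ k • idem₁ k • m = idem₁ k • m := by
  rw [← mul_smul]; congr 1; ext <;> simp [idem₁]

theorem arrowA_smul_idem₀_smul (m : M) : arrowA k • idem₀ k • m = arrowA k • m := by
  rw [← mul_smul, arrowA_mul_idem₀]

theorem arrowB_smul_idem₀_smul (m : M) : arrowB k • idem₀ k • m = arrowB k • m := by
  rw [← mul_smul, arrowB_mul_idem₀]

theorem idem₁_smul_arrowA_smul (m : M) : idem₁ k • arrowA k • m = arrowA k • m := by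
  rw [← mul_smul, idem₁_mul_arrowA]

theorem idem₁_smul_arrowB_smul (m : M) : idem₁ k • arrowB k • m = arrowB k • m := by
  rw [← mul_smul, idem₁_mul_arrowB]

theorem idem₀_smul_add_idem₁_smul (m : M) : idem₀ k • m + idem₁ k • m = m := by
  rw [← add_smul, idem₀_add_idem₁, one_smul]

end Module

end KroneckerAlgebra

open KroneckerAlgebra

/-! ### Homomorphisms to a representation and the extension problem -/

namespace RepSpace

variable {k V W : Type u} [Field k] [AddCommGroup V] [Module k V] [AddCommGroup W] [Module k W]
  {f g : V →ₗ[k] W}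

variable (f g) in
/-- The element of the representation with the given components. -/
def mk (x : V) (y : W) : RepSpace f g := (x, y)

@[simp] theorem mk_fst (x : V) (y : W) : (mk f g x y).1 = x := rfl
@[simp] theorem mk_snd (x : V) (y : W) : (mk f g x y).2 = y := rfl

theorem idem₀_smul (m : RepSpace f g) : idem₀ k • m = mk f g m.1 0 := by
  apply ext' <;> simp [idem₀]

theorem idem₁_smul (m : RepSpace f g) : idem₁ k • m = mk f g 0 m.2 := by
  apply ext' <;> simp [idem₁]

theorem arrowA_smul (m : RepSpace f g) : arrowA k • m = mk f g 0 (f m.1) := by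
  apply ext' <;> simp [arrowA]

theorem arrowB_smul (m : RepSpace f g) : arrowB k • m = mk f g 0 (g m.1) := by
  apply ext' <;> simp [arrowB]

section Hom

section

variable {M : Type v} [AddCommGroup M] [Module (KroneckerAlgebra k) M]
  (h : M →ₗ[KroneckerAlgebra k] RepSpace f g) (m : M)

theorem map_idem₀_smul_fst : (h (idem₀ k • m)).1 = (h m).1 := by
  simp [idem₀_smul]

theorem map_idem₁_smul_snd : (h (idem₁ k • m)).2 = (h m).2 := by
  simp [idem₁_smul]

theorem map_arrowA_smul_snd : (h (arrowA k • m)).2 = f (h m).1 := by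
  simp [arrowA_smul]

theorem map_arrowB_smul_snd : (h (arrowB k • m)).2 = g (h m).1 := by
  simp [arrowB_smul]

end

variable {M : Type v} [AddCommGroup M] [Module k M] [Module (KroneckerAlgebra k) M]
  [IsScalarTower k (KroneckerAlgebra k) M]

/-- The homomorphism to a representation given by its components at the two vertices. -/
def homOfComponents (φ₀ : M →ₗ[k] V) (φ₁ : M →ₗ[k] W)
    (ha : ∀ m : M, f (φ₀ (idem₀ k • m)) = φ₁ (arrowA k • m))
    (hb : ∀ m : M, g (φ₀ (idem₀ k • m)) = φ₁ (arrowB k • m)) :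
    M →ₗ[KroneckerAlgebra k] RepSpace f g where
  toFun m := mk f g (φ₀ (idem₀ k • m)) (φ₁ (idem₁ k • m))
  map_add' m n := by apply ext' <;> simp
  map_smul' x m := by
    apply ext'
    · simp [← mul_smul, idem₀_mul]
    · simp [← mul_smul, idem₁_mul, add_smul, ha, hb]

@[simp] theorem homOfComponents_fst (φ₀ : M →ₗ[k] V) (φ₁ : M →ₗ[k] W) (ha) (hb) (m : M) :
    (homOfComponents (f := f) (g := g) φ₀ φ₁ ha hb m).1 = φ₀ (idem₀ k • m) := rfl

@[simp] theorem homOfComponents_snd (φ₀ : M →ₗ[k] V) (φ₁ : M →ₗ[k] W) (ha) (hb) (m : M) :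
    (homOfComponents (f := f) (g := g) φ₀ φ₁ ha hb m).2 = φ₁ (idem₁ k • m) := rfl

/-- The first component of a homomorphism to a representation. -/
def fstHom (h : M →ₗ[KroneckerAlgebra k] RepSpace f g) : M →ₗ[k] V where
  toFun m := (h m).1
  map_add' m n := by simp
  map_smul' c m := by
    rw [← algebraMap_smul (KroneckerAlgebra k) c m, map_smul, smul_fst]; rfl

/-- The second component of a homomorphism to a representation. -/
def sndHom (h : M →ₗ[KroneckerAlgebra k] RepSpace f g) : M →ₗ[k] W where
  toFun m := (h m).2
  map_add' m n := by simp
  map_smul' c m := by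
    rw [← algebraMap_smul (KroneckerAlgebra k) c m, map_smul, smul_snd, algebraMap_eq]
    simp

theorem fstHom_apply (h : M →ₗ[KroneckerAlgebra k] RepSpace f g) (m : M) :
    fstHom h m = (h m).1 := rfl

theorem sndHom_apply (h : M →ₗ[KroneckerAlgebra k] RepSpace f g) (m : M) :
    sndHom h m = (h m).2 := rfl

variable (f g M) in
/-- Every pair of linear maps from the space of `M` at the vertex `0` to the space of the
representation `f, g` at the vertex `1` is a coboundary; this says that
`Ext¹ (M, RepSpace f g) = 0`. -/
def CoboundarySurjective : Prop :=
  ∀ p q : M →ₗ[k] W, ∃ (φ₀ : M →ₗ[k] V) (φ₁ : M →ₗ[k] W), ∀ m : M,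
    p (idem₀ k • m) = φ₁ (arrowA k • m) - f (φ₀ (idem₀ k • m)) ∧
      q (idem₀ k • m) = φ₁ (arrowB k • m) - g (φ₀ (idem₀ k • m))

/-- The map `p` factors through the range of `F`, and over a field the factor extends to all of `X`.
This is why the maps `F` to which it is applied need not be surjective. -/
theorem exists_comp_eq_of_ker_le {Y X U : Type*} [AddCommGroup Y] [Module k Y] [AddCommGroup X]
    [Module k X] [AddCommGroup U] [Module k U] (F : Y →ₗ[k] X) (p : Y →ₗ[k] U)
    (h : LinearMap.ker F ≤ LinearMap.ker p) : ∃ q : X →ₗ[k] U, ∀ y, q (F y) = p y := by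
  obtain ⟨q, hq⟩ := ((LinearMap.ker F).liftQ p h ∘ₗ
    F.quotKerEquivRange.symm.toLinearMap).exists_extend
  refine ⟨q, fun y => ?_⟩
  have h := LinearMap.congr_fun hq ⟨F y, LinearMap.mem_range_self F y⟩
  simp only [LinearMap.comp_apply, Submodule.subtype_apply, LinearEquiv.coe_coe] at h
  rw [h, show (⟨F y, LinearMap.mem_range_self F y⟩ : LinearMap.range F) =
    F.quotKerEquivRange (Submodule.Quotient.mk y) from rfl, LinearEquiv.symm_apply_apply]
  rfl

/-- Extend both components of `h` linearly. Their failure to commute with the arrows vanishes on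
`ker F`, so it is pulled back from a cocycle on `M`; writing that cocycle as a coboundary gives a
correction that factors through `F` and so leaves `h` unchanged. -/
theorem CoboundarySurjective.exists_extend (hM : CoboundarySurjective f g M)
    {Y : Type w} [AddCommGroup Y] [Module k Y] [Module (KroneckerAlgebra k) Y]
    [IsScalarTower k (KroneckerAlgebra k) Y] (F : Y →ₗ[KroneckerAlgebra k] M)
    (h : LinearMap.ker F →ₗ[KroneckerAlgebra k] RepSpace f g) :
    ∃ H : Y →ₗ[KroneckerAlgebra k] RepSpace f g, ∀ y : LinearMap.ker F, H y = h y := by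
  let K : Submodule k Y := (LinearMap.ker F).restrictScalars k
  let F' : Y →ₗ[k] M := F.restrictScalars k
  have hsmul (c : k) (y : K) : h (c • y) = algebraMap k (KroneckerAlgebra k) c • h y :=
    (congrArg h (Subtype.ext (algebraMap_smul (KroneckerAlgebra k) c (y : Y)).symm)).trans
      (map_smul h _ _)
  obtain ⟨h₀, hh₀⟩ := LinearMap.exists_extend (p := K) (V' := V)
    { toFun y := (h y).1
      map_add' y z := congrArg Prod.fst (map_add h y z)
      map_smul' c y := congrArg Prod.fst (hsmul c y) }
  obtain ⟨h₁, hh₁⟩ := LinearMap.exists_extend (p := K) (V' := W)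
    { toFun y := (h y).2
      map_add' y z := congrArg Prod.snd (map_add h y z)
      map_smul' c y := (congrArg Prod.snd (hsmul c y)).trans (by simp [algebraMap_eq]) }
  replace hh₀ (y : LinearMap.ker F) : h₀ y = (h y).1 := LinearMap.congr_fun hh₀ y
  replace hh₁ (y : LinearMap.ker F) : h₁ y = (h y).2 := LinearMap.congr_fun hh₁ y
  let act (x : KroneckerAlgebra k) : Y →ₗ[k] Y := Algebra.lsmul k k Y x
  -- The defect of the linear extensions `h₀`, `h₁` at an arrow `x`, descended along `F`.
  have key : ∀ (f' : V →ₗ[k] W) (x : KroneckerAlgebra k),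
      (∀ y : LinearMap.ker F, (h (x • y)).2 = f' (h y).1) →
      ∃ p : M →ₗ[k] W, ∀ y, p (F y) = f' (h₀ (idem₀ k • y)) - h₁ (x • y) := by
    intro f' x hx
    refine exists_comp_eq_of_ker_le F' (f' ∘ₗ h₀ ∘ₗ act (idem₀ k) - h₁ ∘ₗ act x) fun y hy => ?_
    have hy' : y ∈ LinearMap.ker F := hy
    change f' (h₀ (idem₀ k • y)) - h₁ (x • y) = 0
    rw [sub_eq_zero]
    exact (congrArg f' (hh₀ (idem₀ k • ⟨y, hy'⟩))).trans
      ((congrArg f' (map_idem₀_smul_fst h _)).trans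
        ((hx ⟨y, hy'⟩).symm.trans (hh₁ (x • ⟨y, hy'⟩)).symm))
  obtain ⟨p, hp⟩ := key f (arrowA k) (map_arrowA_smul_snd h)
  obtain ⟨q, hq⟩ := key g (arrowB k) (map_arrowB_smul_snd h)
  obtain ⟨φ₀, φ₁, hφ⟩ := hM p q
  refine ⟨homOfComponents (h₀ + φ₀ ∘ₗ F') (h₁ + φ₁ ∘ₗ F') (fun y => ?_) (fun y => ?_),
    fun y => ?_⟩
  · have h1 := (hφ (F y)).1
    rw [← map_smul, hp, idem₀_smul_idem₀_smul, arrowA_smul_idem₀_smul] at h1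
    simp only [F', LinearMap.add_apply, LinearMap.comp_apply, LinearMap.restrictScalars_apply,
      map_add, map_smul] at h1 ⊢
    rw [sub_eq_sub_iff_add_eq_add] at h1
    rw [h1, add_comm]
  · have h1 := (hφ (F y)).2
    rw [← map_smul, hq, idem₀_smul_idem₀_smul, arrowB_smul_idem₀_smul] at h1
    simp only [F', LinearMap.add_apply, LinearMap.comp_apply, LinearMap.restrictScalars_apply,
      map_add, map_smul] at h1 ⊢
    rw [sub_eq_sub_iff_add_eq_add] at h1
    rw [h1, add_comm]
  · have hF : F y = 0 := y.2
    apply ext'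
    · simp only [homOfComponents_fst, F', LinearMap.add_apply, LinearMap.comp_apply,
        LinearMap.restrictScalars_apply, map_smul, hF, smul_zero, map_zero, add_zero]
      exact (hh₀ (idem₀ k • y)).trans (map_idem₀_smul_fst h y)
    · simp only [homOfComponents_snd, F', LinearMap.add_apply, LinearMap.comp_apply,
        LinearMap.restrictScalars_apply, map_smul, hF, smul_zero, map_zero, add_zero]
      exact (hh₁ (idem₁ k • y)).trans (map_idem₁_smul_snd h y)

end Hom

end RepSpace

/-! ### Extensions given by cocycles -/

/-- The extension of the module `M` by the representation `f, g` that is given by the cocycle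
`p, q`. -/
@[nolint unusedArguments]
def CocycleExtension {k V W : Type u} {M : Type v} [Field k] [AddCommGroup V] [Module k V]
    [AddCommGroup W] [Module k W] [AddCommGroup M] [Module k M] (f g : V →ₗ[k] W)
    (_p _q : M →ₗ[k] W) : Type (max u v) :=
  RepSpace f g × M

namespace CocycleExtension

variable {k V W : Type u} [Field k] [AddCommGroup V] [Module k V] [AddCommGroup W] [Module k W]
  {f g : V →ₗ[k] W} {M : Type v} [AddCommGroup M] [Module k M] {p q : M →ₗ[k] W}

instance : AddCommGroup (CocycleExtension f g p q) :=
  inferInstanceAs (AddCommGroup (RepSpace f g × M))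

variable (f g p q) in
/-- The element of the extension with the given components. -/
def mk (x : RepSpace f g) (m : M) : CocycleExtension f g p q := (x, m)

@[simp] theorem mk_fst (x : RepSpace f g) (m : M) : (mk f g p q x m).1 = x := rfl
@[simp] theorem mk_snd (x : RepSpace f g) (m : M) : (mk f g p q x m).2 = m := rfl

theorem ext' {m n : CocycleExtension f g p q} (h₁ : m.1.1 = n.1.1) (h₂ : m.1.2 = n.1.2)
    (h₃ : m.2 = n.2) : m = n :=
  Prod.ext (RepSpace.ext' f g h₁ h₂) h₃

@[simp] theorem add_fst (m n : CocycleExtension f g p q) : (m + n).1 = m.1 + n.1 := rfl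
@[simp] theorem add_snd (m n : CocycleExtension f g p q) : (m + n).2 = m.2 + n.2 := rfl
@[simp] theorem zero_fst : (0 : CocycleExtension f g p q).1 = 0 := rfl
@[simp] theorem zero_snd : (0 : CocycleExtension f g p q).2 = 0 := rfl
variable [Module (KroneckerAlgebra k) M]

/-- The cocycle twists only the arrows, and only the values of `p` and `q` on the space at the
vertex `0` matter. -/
instance : SMul (KroneckerAlgebra k) (CocycleExtension f g p q) :=
  ⟨fun x m => (x • m.1 +
    RepSpace.mk f g 0 (x.a • p (idem₀ k • m.2) + x.b • q (idem₀ k • m.2)), x • m.2)⟩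

@[simp] theorem smul_fst_fst (x : KroneckerAlgebra k) (m : CocycleExtension f g p q) :
    (x • m).1.1 = x.e₀ • m.1.1 := add_zero _
@[simp] theorem smul_fst_snd (x : KroneckerAlgebra k) (m : CocycleExtension f g p q) :
    (x • m).1.2 = x.e₁ • m.1.2 + x.a • f m.1.1 + x.b • g m.1.1 +
      (x.a • p (idem₀ k • m.2) + x.b • q (idem₀ k • m.2)) := rfl
@[simp] theorem smul_snd (x : KroneckerAlgebra k) (m : CocycleExtension f g p q) :
    (x • m).2 = x • m.2 := rfl

variable [IsScalarTower k (KroneckerAlgebra k) M]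

instance : Module (KroneckerAlgebra k) (CocycleExtension f g p q) where
  one_smul m := by apply ext' <;> simp
  mul_smul x y m := by
    apply ext'
    · simp [mul_smul]
    · simp only [smul_fst_fst, smul_fst_snd, smul_snd, KroneckerAlgebra.mul_e₁,
        KroneckerAlgebra.mul_a, KroneckerAlgebra.mul_b, map_smul, ← mul_smul (idem₀ k) y,
        idem₀_mul, smul_assoc]
      module
    · simp [mul_smul]
  smul_zero x := by apply ext' <;> simp
  smul_add x m n := by
    apply ext'
    · simp
    · simp only [add_fst, add_snd, RepSpace.add_fst, RepSpace.add_snd, smul_fst_snd, smul_add,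
        map_add]
      module
    · simp
  add_smul x y m := by
    apply ext'
    · simp [add_smul]
    · simp only [add_fst, RepSpace.add_snd, smul_fst_snd, KroneckerAlgebra.add_e₁,
        KroneckerAlgebra.add_a, KroneckerAlgebra.add_b]
      module
    · simp [add_smul]
  zero_smul m := by apply ext' <;> simp

variable (f g p q)

/-- The inclusion of the representation into the extension. -/
def inl : RepSpace f g →ₗ[KroneckerAlgebra k] CocycleExtension f g p q where
  toFun m := mk f g p q m 0
  map_add' m n := by apply ext' <;> simp
  map_smul' x m := by apply ext' <;> simp

/-- The projection of the extension to the module. -/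
def snd : CocycleExtension f g p q →ₗ[KroneckerAlgebra k] M where
  toFun m := m.2
  map_add' _ _ := rfl
  map_smul' _ _ := rfl

theorem inl_injective : Function.Injective (inl f g p q) :=
  fun _ _ h => congrArg Prod.fst h

theorem snd_surjective : Function.Surjective (snd f g p q) :=
  fun m => ⟨mk f g p q 0 m, rfl⟩

theorem exact_inl_snd : Function.Exact (inl f g p q) (snd f g p q) := by
  intro m
  refine ⟨fun h => ⟨m.1, Prod.ext rfl h.symm⟩, ?_⟩
  rintro ⟨n, rfl⟩
  rfl

variable {f g p q}

/-- The obvious `k`-linear section `s` of the extension fails to be a module homomorphism exactly by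
the cocycle. Applying `r` to this defect exhibits the cocycle as the coboundary of the components of
`-(r ∘ s)`. -/
theorem exists_coboundary_of_retraction
    (r : CocycleExtension f g p q →ₗ[KroneckerAlgebra k] RepSpace f g)
    (hr : ∀ m, r (inl f g p q m) = m) :
    ∃ (φ₀ : M →ₗ[k] V) (φ₁ : M →ₗ[k] W), ∀ m : M,
      p (idem₀ k • m) = φ₁ (arrowA k • m) - f (φ₀ (idem₀ k • m)) ∧
        q (idem₀ k • m) = φ₁ (arrowB k • m) - g (φ₀ (idem₀ k • m)) := by
  let : Module k (CocycleExtension f g p q) :=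
    Module.compHom _ (algebraMap k (KroneckerAlgebra k))
  have : IsScalarTower k (KroneckerAlgebra k) (CocycleExtension f g p q) :=
    IsScalarTower.of_algebraMap_smul fun _ _ => rfl
  let s : M →ₗ[k] CocycleExtension f g p q :=
    { toFun m := mk f g p q 0 m
      map_add' m n := by apply ext' <;> simp
      map_smul' c m := by
        refine Eq.trans ?_ (algebraMap_smul (KroneckerAlgebra k) c (mk f g p q 0 m))
        apply ext'
        · simp [-algebraMap_smul]
        · simp [-algebraMap_smul, algebraMap_eq]
        · exact (algebraMap_smul (KroneckerAlgebra k) c m).symm }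
  have hs (x : KroneckerAlgebra k) (m : M) : x • s m = s (x • m) +
      inl f g p q (RepSpace.mk f g 0 (x.a • p (idem₀ k • m) + x.b • q (idem₀ k • m))) := by
    apply ext' <;> simp [s, inl]
  refine ⟨-(RepSpace.fstHom r ∘ₗ s), -(RepSpace.sndHom r ∘ₗ s), fun m => ⟨?_, ?_⟩⟩
  · have h1 := RepSpace.map_arrowA_smul_snd r (s (idem₀ k • m))
    rw [hs, map_add, hr, arrowA_smul_idem₀_smul, idem₀_smul_idem₀_smul] at h1
    simp only [arrowA, RepSpace.add_snd, RepSpace.mk_snd, one_smul, zero_smul, add_zero] at h1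
    simp only [LinearMap.neg_apply, LinearMap.comp_apply, RepSpace.fstHom_apply,
      RepSpace.sndHom_apply, map_neg, ← h1, arrowA]
    abel
  · have h1 := RepSpace.map_arrowB_smul_snd r (s (idem₀ k • m))
    rw [hs, map_add, hr, arrowB_smul_idem₀_smul, idem₀_smul_idem₀_smul] at h1
    simp only [arrowB, RepSpace.add_snd, RepSpace.mk_snd, one_smul, zero_smul, zero_add] at h1
    simp only [LinearMap.neg_apply, LinearMap.comp_apply, RepSpace.fstHom_apply,
      RepSpace.sndHom_apply, map_neg, ← h1, arrowB]
    abel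

end CocycleExtension

/-! ### Endomorphisms and functionals of representations of the shape `P(I)` -/

open Module in
/-- The representation `f, g` has bases of the same shape as the module `P(I)`: the basis of the
space at the vertex `0` corresponds to the functions `1 / (T - c)`, and the one of the space at
the vertex `1` has the additional element `1`. -/
structure IsRingelRep {k V W : Type u} [Field k] [AddCommGroup V] [Module k V] [AddCommGroup W]
    [Module k W] {I : Set k} (f g : V →ₗ[k] W) (bV : Basis I k V) (bW : Basis (Option I) k W) :
    Prop where
  map_f : ∀ c : I, f (bV c) = bW (some c)
  map_g : ∀ c : I, g (bV c) = (c : k) • bW (some c) + bW none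

namespace IsRingelRep

variable {k V W : Type u} [Field k] [AddCommGroup V] [Module k V] [AddCommGroup W] [Module k W]
  {I : Set k} {f g : V →ₗ[k] W} {bV : Module.Basis I k V} {bW : Module.Basis (Option I) k W}

theorem repr_f_some (h : IsRingelRep f g bV bW) (v : V) (c : I) :
    bW.repr (f v) (some c) = bV.repr v c := by
  suffices H : Finsupp.lapply (some c) ∘ₗ bW.repr.toLinearMap ∘ₗ f =
      Finsupp.lapply c ∘ₗ bV.repr.toLinearMap from LinearMap.congr_fun H v
  refine bV.ext fun d => ?_
  by_cases hcd : d = c <;> simp [h.map_f, hcd]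

theorem repr_g_some (h : IsRingelRep f g bV bW) (v : V) (c : I) :
    bW.repr (g v) (some c) = c * bV.repr v c := by
  suffices H : Finsupp.lapply (some c) ∘ₗ bW.repr.toLinearMap ∘ₗ g =
      (c : k) • Finsupp.lapply c ∘ₗ bV.repr.toLinearMap from LinearMap.congr_fun H v
  refine bV.ext fun d => ?_
  by_cases hcd : d = c <;> simp [h.map_g, hcd]

theorem repr_f_none (h : IsRingelRep f g bV bW) (v : V) : bW.repr (f v) none = 0 := by
  suffices H : Finsupp.lapply none ∘ₗ bW.repr.toLinearMap ∘ₗ f = 0 from LinearMap.congr_fun H v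
  refine bV.ext fun d => ?_
  simp [h.map_f]

/-- Every endomorphism of the representation is the multiplication by a scalar. -/
theorem exists_eq_smul (h : IsRingelRep f g bV bW) (θ₀ : V →ₗ[k] V) (θ₁ : W →ₗ[k] W)
    (hf : ∀ v, θ₁ (f v) = f (θ₀ v)) (hg : ∀ v, θ₁ (g v) = g (θ₀ v)) :
    ∃ r : k, (∀ v, θ₀ v = r • v) ∧ ∀ w, θ₁ w = r • w := by
  -- The identity `1 = (T - c) · 1 / (T - c)`, transported by the endomorphism.
  have key (c : I) : θ₁ (bW none) = g (θ₀ (bV c)) - (c : k) • f (θ₀ (bV c)) := by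
    rw [← hf, ← hg, h.map_f, h.map_g]
    simp
  -- A multiple of `T - c` has no pole at `c`. As `c` varies over `I`, the image of `1` loses all
  -- its poles and is a scalar multiple of `1`.
  have hsome (c : I) : bW.repr (θ₁ (bW none)) (some c) = 0 := by
    rw [key c]
    simp [h.repr_f_some, h.repr_g_some]
  have hone : θ₁ (bW none) = bW.repr (θ₁ (bW none)) none • bW none := by
    refine bW.ext_elem fun i => ?_
    cases i with
    | none => simp
    | some c => simp [hsome]
  set r := bW.repr (θ₁ (bW none)) none
  have hV (c : I) : θ₀ (bV c) = r • bV c := by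
    -- By `key c`, the coefficient of the image of `1` at `d` is `d - c` times this one, and it is
    -- zero.
    have hne (d : I) (hd : d ≠ c) : bV.repr (θ₀ (bV c)) d = 0 := by
      have h1 := hsome d
      rw [key c] at h1
      simp only [map_sub, map_smul, Finsupp.sub_apply, Finsupp.smul_apply, h.repr_f_some,
        h.repr_g_some, smul_eq_mul, ← sub_mul, mul_eq_zero, sub_eq_zero] at h1
      exact h1.resolve_left fun h2 => hd (Subtype.ext h2)
    have h2 : θ₀ (bV c) = bV.repr (θ₀ (bV c)) c • bV c := by
      refine bV.ext_elem fun d => ?_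
      by_cases hd : d = c
      · simp [hd]
      · simp [hne d hd, Ne.symm hd]
    have h3 := key c
    rw [h2, map_smul, map_smul, h.map_f, h.map_g, hone] at h3
    -- Comparing coefficients of `1` identifies the remaining diagonal coefficient with `r`.
    have h4 := congrArg (fun w => bW.repr w none) h3
    simp at h4
    rw [h2, ← h4]
  refine ⟨r, fun v => ?_, fun w => ?_⟩
  · exact LinearMap.congr_fun (g := r • LinearMap.id) (bV.ext hV) v
  · refine LinearMap.congr_fun (g := r • LinearMap.id) (bW.ext fun i => ?_) w
    cases i with
    | none => exact hone
    | some c => simp [← h.map_f, hf, hV]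

theorem endomorphism_eq_smul (h : IsRingelRep f g bV bW)
    (θ : RepSpace f g →ₗ[KroneckerAlgebra k] RepSpace f g) :
    ∃ r : k, ∀ m, θ m = algebraMap k (KroneckerAlgebra k) r • m := by
  let θ₀ : V →ₗ[k] V :=
    { toFun v := (θ (RepSpace.mk f g v 0)).1
      map_add' v w := by
        rw [← RepSpace.add_fst, ← map_add]
        congr 2
        apply RepSpace.ext' <;> simp
      map_smul' c v := by
        rw [show RepSpace.mk f g (c • v) 0 =
          algebraMap k (KroneckerAlgebra k) c • RepSpace.mk f g v 0 by
            apply RepSpace.ext' <;> simp [algebraMap_eq], map_smul]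
        simp [algebraMap_eq] }
  let θ₁ : W →ₗ[k] W :=
    { toFun v := (θ (RepSpace.mk f g 0 v)).2
      map_add' v w := by
        rw [← RepSpace.add_snd, ← map_add]
        congr 2
        apply RepSpace.ext' <;> simp
      map_smul' c v := by
        rw [show RepSpace.mk f g 0 (c • v) =
          algebraMap k (KroneckerAlgebra k) c • RepSpace.mk f g 0 v by
            apply RepSpace.ext' <;> simp [algebraMap_eq], map_smul]
        simp [algebraMap_eq] }
  obtain ⟨r, hr₀, hr₁⟩ := h.exists_eq_smul θ₀ θ₁
    (fun v => by
      have hv := RepSpace.map_arrowA_smul_snd θ (RepSpace.mk f g v 0)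
      rwa [RepSpace.arrowA_smul] at hv)
    (fun v => by
      have hv := RepSpace.map_arrowB_smul_snd θ (RepSpace.mk f g v 0)
      rwa [RepSpace.arrowB_smul] at hv)
  refine ⟨r, fun m => ?_⟩
  apply RepSpace.ext'
  · rw [← RepSpace.map_idem₀_smul_fst, RepSpace.idem₀_smul]
    exact (hr₀ m.1).trans (by simp [algebraMap_eq])
  · rw [← RepSpace.map_idem₁_smul_snd, RepSpace.idem₁_smul]
    exact (hr₁ m.2).trans (by simp [algebraMap_eq])

/-- The functional is the coefficient of `1`. -/
theorem exists_functional_f (h : IsRingelRep f g bV bW) :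
    ∃ φ : W →ₗ[k] k, φ ≠ 0 ∧ φ ∘ₗ f = 0 := by
  refine ⟨bW.coord none, fun h0 => ?_, LinearMap.ext fun v => h.repr_f_none v⟩
  simpa using LinearMap.congr_fun h0 (bW none)

/-- The multiplication by `T - c` has a cokernel. -/
theorem exists_functional_sub (h : IsRingelRep f g bV bW) (c : k) :
    ∃ φ : W →ₗ[k] k, φ ≠ 0 ∧ φ ∘ₗ (g - c • f) = 0 := by
  by_cases hc : c ∈ I
  -- For `c ∈ I`, the functional is the residue at `c`.
  · refine ⟨bW.coord (some ⟨c, hc⟩), fun h0 => ?_, LinearMap.ext fun v => ?_⟩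
    · simpa using LinearMap.congr_fun h0 (bW (some ⟨c, hc⟩))
    · simp [h.repr_f_some, h.repr_g_some]
  -- For `c ∉ I`, it is the evaluation at `T = c`, where no element of `W` has a pole.
  · refine ⟨bW.constr k fun i => i.elim 1 fun d => (c - (d : k))⁻¹, fun h0 => ?_,
      bV.ext fun d => ?_⟩
    · simpa [Module.Basis.constr_basis] using LinearMap.congr_fun h0 (bW none)
    · have hd : c - (d : k) ≠ 0 := sub_ne_zero.mpr fun h1 => hc (h1 ▸ d.2)
      simp [h.map_f, h.map_g, Module.Basis.constr_basis]
      field_simp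
      ring

end IsRingelRep

/-! ### Partial fractions and the bases of `P(I)` -/

section Basis

variable {k : Type u} [Field k]

/-- Modulo polynomials, `1 / (T - c)` is an eigenvector of multiplication by `T` with eigenvalue
`c`, so these classes are independent. Since `1` is zero modulo polynomials, it cannot be a
combination of them. -/
theorem linearIndependent_one_div_X_sub_C :
    LinearIndependent k (fun c : Option k =>
      c.elim (1 : RatFunc k) fun c => 1 / (RatFunc.X - RatFunc.C c)) := by
  let P : Submodule k (RatFunc k) :=
    LinearMap.range (IsScalarTower.toAlgHom k (Polynomial k) (RatFunc k)).toLinearMap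
  have hmem (x : RatFunc k) : x ∈ P ↔ ∃ p : Polynomial k, algebraMap _ (RatFunc k) p = x := Iff.rfl
  have hX : P ≤ P.comap (LinearMap.mulLeft k (RatFunc.X : RatFunc k)) := by
    rintro _ ⟨p, rfl⟩
    exact ⟨Polynomial.X * p, by simp⟩
  have hne (c : k) : (RatFunc.X - RatFunc.C c : RatFunc k) ≠ 0 := by
    rw [← RatFunc.algebraMap_X, ← RatFunc.algebraMap_C, ← map_sub]
    exact RatFunc.algebraMap_ne_zero (Polynomial.X_sub_C_ne_zero c)
  have hli : LinearIndependent k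
      (P.mkQ ∘ fun c : k => (1 / (RatFunc.X - RatFunc.C c) : RatFunc k)) := by
    refine Module.End.eigenvectors_linearIndependent' (P.mapQ P _ hX) id Function.injective_id _
      fun c => ⟨?_, fun h0 => ?_⟩
    · rw [Module.End.mem_eigenspace_iff]
      change P.mkQ (RatFunc.X * _) = c • P.mkQ _
      rw [← map_smul, ← sub_eq_zero, ← map_sub, Submodule.mkQ_apply,
        Submodule.Quotient.mk_eq_zero, hmem]
      refine ⟨1, ?_⟩
      have := hne c
      rw [RatFunc.smul_eq_C_mul]
      simp only [map_one]
      field_simp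
    · rw [Function.comp_apply, Submodule.mkQ_apply, Submodule.Quotient.mk_eq_zero, hmem] at h0
      obtain ⟨p, hp⟩ := h0
      rw [eq_div_iff (hne c), ← RatFunc.algebraMap_X, ← RatFunc.algebraMap_C, ← map_sub,
        ← map_mul, ← map_one (algebraMap (Polynomial k) (RatFunc k))] at hp
      exact Polynomial.not_isUnit_X_sub_C c
        (IsUnit.of_mul_eq_one p ((mul_comm _ _).trans (RatFunc.algebraMap_injective k hp)))
  refine linearIndependent_option.mpr ⟨hli.of_comp _, fun h1 => ?_⟩
  obtain ⟨l, hl⟩ := (Finsupp.mem_span_range_iff_exists_finsupp).mp h1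
  have h2 : l = 0 := by
    refine linearIndependent_iff.mp hli l ?_
    have h3 : P.mkQ (1 : RatFunc k) = 0 := by
      rw [Submodule.mkQ_apply, Submodule.Quotient.mk_eq_zero, hmem]
      exact ⟨1, map_one _⟩
    rw [Finsupp.linearCombination_apply, ← h3]
    refine Eq.trans ?_ (congrArg P.mkQ hl)
    rw [map_finsuppSum]
    simp
  rw [h2, Finsupp.sum_zero_index] at hl
  exact zero_ne_one hl

theorem exists_isRingelRep_ringelModule (I : Set k) :
    ∃ (bV : Module.Basis I k (ringelV I)) (bW : Module.Basis (Option I) k (ringelW I)),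
      IsRingelRep (Submodule.inclusion (ringelV_le_ringelW I))
        ((LinearMap.mulLeft k (RatFunc.X : RatFunc k)).restrict
          (fun _ hv => X_mul_mem_ringelW I hv)) bV bW := by
  have hW := (linearIndependent_one_div_X_sub_C (k := k)).comp (Option.map ((↑) : I → k))
    (Option.map_injective Subtype.val_injective)
  have hV := hW.comp some (Option.some_injective I)
  have hVspan : Submodule.span k (Set.range fun c : I =>
      (1 / (RatFunc.X - RatFunc.C (c : k)) : RatFunc k)) = ringelV I := by
    rw [ringelV, Set.image_eq_range]
  have hWspan : Submodule.span k (Set.range ((fun c : Option k =>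
      c.elim (1 : RatFunc k) fun c => 1 / (RatFunc.X - RatFunc.C c)) ∘
        Option.map ((↑) : I → k))) = ringelW I := by
    rw [ringelW, ← hVspan, ← Submodule.span_union, Set.union_comm]
    congr 1
    ext x
    simp [Option.exists, eq_comm]
  let bV := (Module.Basis.span hV).map (LinearEquiv.ofEq _ _ hVspan)
  let bW := (Module.Basis.span hW).map (LinearEquiv.ofEq _ _ hWspan)
  have hbV (c : I) : (bV c : RatFunc k) = 1 / (RatFunc.X - RatFunc.C (c : k)) :=
    congrArg Subtype.val (Module.Basis.span_apply hV c) |>.trans rfl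
  have hbW (c : I) : (bW (some c) : RatFunc k) = 1 / (RatFunc.X - RatFunc.C (c : k)) := by
    simp [bW, Module.Basis.span_apply]
  have hbW₁ : (bW none : RatFunc k) = 1 := by
    simp [bW, Module.Basis.span_apply]
  refine ⟨bV, bW, fun c => Subtype.ext ?_, fun c => Subtype.ext ?_⟩
  · rw [Submodule.coe_inclusion, hbV, hbW]
  · have hne : (RatFunc.X - RatFunc.C (c : k) : RatFunc k) ≠ 0 := by
      rw [← RatFunc.algebraMap_X, ← RatFunc.algebraMap_C, ← map_sub]
      exact RatFunc.algebraMap_ne_zero (Polynomial.X_sub_C_ne_zero _)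
    rw [LinearMap.coe_restrict_apply, Submodule.coe_add, Submodule.coe_smul, hbV, hbW, hbW₁,
      LinearMap.mulLeft_apply, RatFunc.smul_eq_C_mul]
    field_simp
    ring

end Basis

/-! ### Finite-dimensional modules with `Hom (M, B) = 0 = Ext¹ (M, B)` -/

namespace RepSpace

variable {k V W : Type u} [Field k] [AddCommGroup V] [Module k V] [AddCommGroup W] [Module k W]
  {f g : V →ₗ[k] W} {M : Type v} [AddCommGroup M] [Module k M] [Module (KroneckerAlgebra k) M]

/-- If the map `s f + t g` is not surjective, then the combination `s a + t b` of the arrows is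
injective on the modules `M` with `Ext¹ (M, RepSpace f g) = 0`. -/
theorem CoboundarySurjective.eq_zero (hM : CoboundarySurjective f g M) {s t s' t' : k}
    (hst : s * s' + t * t' = 1) {ψ : W →ₗ[k] k} (hψ : ψ ≠ 0) (hψ' : ψ ∘ₗ (s • f + t • g) = 0)
    {x : M} (hx : idem₀ k • x = x) (hx' : s • arrowA k • x + t • arrowB k • x = 0) : x = 0 := by
  refine (Module.forall_dual_apply_eq_zero_iff k x).mp fun φ => ?_
  obtain ⟨w, hw⟩ : ∃ w, ψ w ≠ 0 := by
    by_contra! h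
    exact hψ (LinearMap.ext h)
  -- The cocycle is chosen so that `s p + t q` is `φ` times `w`. At `x` the `φ₁` terms cancel, which
  -- puts `φ x • w` in the image of `s f + t g`, where `ψ` vanishes.
  obtain ⟨φ₀, φ₁, h⟩ := hM (s' • φ.smulRight w) (t' • φ.smulRight w)
  obtain ⟨h1, h2⟩ := h x
  rw [hx] at h1 h2
  have h3 := LinearMap.congr_fun hψ' (φ₀ x)
  have h4 := congrArg (fun y => ψ (φ₁ y)) hx'
  replace h1 := congrArg ψ h1
  replace h2 := congrArg ψ h2
  simp only [LinearMap.smul_apply, LinearMap.smulRight_apply, map_smul, map_sub, map_add,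
    map_zero, LinearMap.comp_apply, LinearMap.add_apply, LinearMap.zero_apply, smul_eq_mul]
    at h1 h2 h3 h4
  refine (mul_eq_zero.mp ?_).resolve_right hw
  linear_combination s * h1 + t * h2 - h3 + h4 - φ x * ψ w * hst

end RepSpace

namespace IsRingelRep

variable {k V W : Type u} [Field k] [AddCommGroup V] [Module k V] [AddCommGroup W] [Module k W]
  {I : Set k} {f g : V →ₗ[k] W} {bV : Module.Basis I k V} {bW : Module.Basis (Option I) k W}
  {M : Type v} [AddCommGroup M] [Module k M] [Module (KroneckerAlgebra k) M]
  [IsScalarTower k (KroneckerAlgebra k) M]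

open Module

/-- A count of dimensions that yields a nonzero homomorphism between representations. -/
theorem exists_ne_zero_comp_eq_comp {M₀ M₁ A₀ A₁ : Type*} [AddCommGroup M₀] [Module k M₀]
    [AddCommGroup M₁] [Module k M₁] [AddCommGroup A₀] [Module k A₀] [AddCommGroup A₁] [Module k A₁]
    [Module.Finite k M₀] [Module.Finite k M₁] [Module.Finite k A₀] [Module.Finite k A₁]
    (α β : M₀ →ₗ[k] M₁) (f g : A₀ →ₗ[k] A₁)
    (hlt : finrank k M₀ * finrank k A₁ + finrank k M₀ * finrank k A₁ <
      finrank k M₀ * finrank k A₀ + finrank k M₁ * finrank k A₁) :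
    ∃ (φ₀ : M₀ →ₗ[k] A₀) (φ₁ : M₁ →ₗ[k] A₁), ¬ (φ₀ = 0 ∧ φ₁ = 0) ∧
      f ∘ₗ φ₀ = φ₁ ∘ₗ α ∧ g ∘ₗ φ₀ = φ₁ ∘ₗ β := by
  let L : (M₀ →ₗ[k] A₀) × (M₁ →ₗ[k] A₁) →ₗ[k] (M₀ →ₗ[k] A₁) × (M₀ →ₗ[k] A₁) :=
    { toFun φ := (φ.2 ∘ₗ α - f ∘ₗ φ.1, φ.2 ∘ₗ β - g ∘ₗ φ.1)
      map_add' φ ψ := by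
        ext : 2 <;> simp <;> abel
      map_smul' c φ := by
        ext : 2 <;> simp [smul_sub] }
  have hL : LinearMap.ker L ≠ ⊥ := by
    refine LinearMap.ker_ne_bot_of_finrank_lt ?_
    simpa only [finrank_prod, finrank_linearMap] using hlt
  obtain ⟨φ, hφ, hne⟩ := (Submodule.ne_bot_iff _).mp hL
  exact ⟨φ.1, φ.2, fun h0 => hne (Prod.ext h0.1 h0.2),
    (sub_eq_zero.mp (congrArg Prod.fst hφ)).symm, (sub_eq_zero.mp (congrArg Prod.snd hφ)).symm⟩

/-- Choosing `m = dim M₀` points of `I` gives a subrepresentation with dimensions `m` and `m + 1`;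
the homomorphism is found inside it by counting unknowns and equations. -/
theorem exists_ne_zero_of_finrank_lt (h : IsRingelRep f g bV bW) (hI : I.Infinite)
    {M₀ M₁ : Type*} [AddCommGroup M₀] [Module k M₀] [AddCommGroup M₁] [Module k M₁]
    [Module.Finite k M₀] [Module.Finite k M₁] (α β : M₀ →ₗ[k] M₁)
    (hlt : finrank k M₀ < finrank k M₁) :
    ∃ (φ₀ : M₀ →ₗ[k] V) (φ₁ : M₁ →ₗ[k] W), ¬ (φ₀ = 0 ∧ φ₁ = 0) ∧
      f ∘ₗ φ₀ = φ₁ ∘ₗ α ∧ g ∘ₗ φ₀ = φ₁ ∘ₗ β := by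
  let m := finrank k M₀
  have := hI.to_subtype
  let σ : Fin m ↪ I := (Fin.valEmbedding).trans (Infinite.natEmbedding I)
  let ιV : (Fin m →₀ k) →ₗ[k] V := Finsupp.linearCombination k (bV ∘ σ)
  let ιW : (Option (Fin m) →₀ k) →ₗ[k] W := Finsupp.linearCombination k (bW ∘ Option.map σ)
  have hιV : Function.Injective ιV := bV.linearIndependent.comp _ σ.injective
  have hιW : Function.Injective ιW :=
    bW.linearIndependent.comp _ (Option.map_injective σ.injective)
  let f' : (Fin m →₀ k) →ₗ[k] (Option (Fin m) →₀ k) :=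
    Finsupp.linearCombination k fun j => Finsupp.single (some j) 1
  let g' : (Fin m →₀ k) →ₗ[k] (Option (Fin m) →₀ k) :=
    Finsupp.linearCombination k fun j =>
      (σ j : k) • Finsupp.single (some j) 1 + Finsupp.single none 1
  have hf' : f ∘ₗ ιV = ιW ∘ₗ f' := by
    refine Finsupp.lhom_ext' fun j => LinearMap.ext_ring ?_
    simp [ιV, ιW, f', h.map_f]
  have hg' : g ∘ₗ ιV = ιW ∘ₗ g' := by
    refine Finsupp.lhom_ext' fun j => LinearMap.ext_ring ?_
    simp [ιV, ιW, g', h.map_g]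
  -- There are `2 m (m + 1)` equations and, as `dim M₁ ≥ m + 1`, at least `m² + (m + 1)²` unknowns:
  -- one more suffices, and this is where the size `m` is used.
  obtain ⟨φ₀, φ₁, hne, hφf, hφg⟩ := exists_ne_zero_comp_eq_comp α β f' g' (by
    simp only [finrank_finsupp_self, Fintype.card_option, Fintype.card_fin]
    change m < _ at hlt
    change m * (m + 1) + m * (m + 1) < m * m + _
    nlinarith)
  refine ⟨ιV ∘ₗ φ₀, ιW ∘ₗ φ₁, fun h0 => hne ⟨?_, ?_⟩, ?_, ?_⟩
  · exact LinearMap.ext fun x => hιV ((LinearMap.congr_fun h0.1 x).trans (map_zero ιV).symm)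
  · exact LinearMap.ext fun x => hιW ((LinearMap.congr_fun h0.2 x).trans (map_zero ιW).symm)
  · rw [← LinearMap.comp_assoc, hf', LinearMap.comp_assoc, hφf, LinearMap.comp_assoc]
  · rw [← LinearMap.comp_assoc, hg', LinearMap.comp_assoc, hφg, LinearMap.comp_assoc]

/-- Injectivity of the arrow `a` leaves two cases: `dim M₀ < dim M₁` is excluded by a dimension
count, and equality with `M₀ ≠ 0` by an eigenvector of `a⁻¹ b`. -/
theorem subsingleton_of_finite [IsAlgClosed k] (h : IsRingelRep f g bV bW) (hI : I.Infinite)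
    [Module.Finite k M] (hM : RepSpace.CoboundarySurjective f g M)
    (hM' : ∀ φ : M →ₗ[KroneckerAlgebra k] RepSpace f g, φ = 0) : Subsingleton M := by
  let act (x : KroneckerAlgebra k) : M →ₗ[k] M := Algebra.lsmul k k M x
  let M₀ := LinearMap.range (act (idem₀ k))
  let M₁ := LinearMap.range (act (idem₁ k))
  have hM₀ (x : M₀) : idem₀ k • (x : M) = x := by
    obtain ⟨_, y, rfl⟩ := x
    exact idem₀_smul_idem₀_smul y
  let α : M₀ →ₗ[k] M₁ := (act (arrowA k) ∘ₗ M₀.subtype).codRestrict M₁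
    fun x => ⟨arrowA k • (x : M), idem₁_smul_arrowA_smul _⟩
  let β : M₀ →ₗ[k] M₁ := (act (arrowB k) ∘ₗ M₀.subtype).codRestrict M₁
    fun x => ⟨arrowB k • (x : M), idem₁_smul_arrowB_smul _⟩
  have hα (x : M₀) : (α x : M) = arrowA k • (x : M) := rfl
  have hβ (x : M₀) : (β x : M) = arrowB k • (x : M) := rfl
  have hinj : Function.Injective α := by
    refine (injective_iff_map_eq_zero α).mpr fun x hx => Subtype.ext ?_
    obtain ⟨ψ, hψ, hψ'⟩ := h.exists_functional_f
    refine hM.eq_zero (s := 1) (t := 0) (s' := 1) (t' := 0) (by simp) hψ (by simpa using hψ')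
      (hM₀ x) ?_
    simp [← hα, hx]
  rcases (LinearMap.finrank_le_finrank_of_injective hinj).lt_or_eq with hlt | heq
  · exfalso
    obtain ⟨φ₀, φ₁, hne, hφf, hφg⟩ := h.exists_ne_zero_of_finrank_lt hI α β hlt
    have h1 := hM' (RepSpace.homOfComponents (φ₀ ∘ₗ (act (idem₀ k)).rangeRestrict)
      (φ₁ ∘ₗ (act (idem₁ k)).rangeRestrict)
      (fun m => by
        refine (LinearMap.congr_fun hφf _).trans (congrArg φ₁ (Subtype.ext ?_))
        rw [hα]
        change arrowA k • idem₀ k • idem₀ k • m = idem₁ k • arrowA k • m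
        rw [arrowA_smul_idem₀_smul, arrowA_smul_idem₀_smul, idem₁_smul_arrowA_smul])
      (fun m => by
        refine (LinearMap.congr_fun hφg _).trans (congrArg φ₁ (Subtype.ext ?_))
        rw [hβ]
        change arrowB k • idem₀ k • idem₀ k • m = idem₁ k • arrowB k • m
        rw [arrowB_smul_idem₀_smul, arrowB_smul_idem₀_smul, idem₁_smul_arrowB_smul]))
    refine hne ⟨LinearMap.ext ?_, LinearMap.ext ?_⟩
    · rintro ⟨_, y, rfl⟩
      refine Eq.trans (congrArg φ₀ (Subtype.ext ?_))
        (congrArg Prod.fst (LinearMap.congr_fun h1 y))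
      exact (idem₀_smul_idem₀_smul y).symm
    · rintro ⟨_, y, rfl⟩
      refine Eq.trans (congrArg φ₁ (Subtype.ext ?_))
        (congrArg Prod.snd (LinearMap.congr_fun h1 y))
      exact (idem₁_smul_idem₁_smul y).symm
  · have hM₀' : Subsingleton M₀ := by
      by_contra hn
      rw [not_subsingleton_iff_nontrivial] at hn
      let e := LinearEquiv.ofInjectiveOfFinrankEq α hinj heq
      obtain ⟨c, hc⟩ := Module.End.exists_eigenvalue (e.symm.toLinearMap ∘ₗ β)
      obtain ⟨x, hx⟩ := hc.exists_hasEigenvector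
      obtain ⟨ψ, hψ, hψ'⟩ := h.exists_functional_sub c
      have h1 : β x = c • α x := by
        have h2 := congrArg e hx.apply_eq_smul
        rw [LinearMap.comp_apply, LinearEquiv.coe_coe, LinearEquiv.apply_symm_apply,
          map_smul] at h2
        exact h2
      -- The eigenvector is killed by `b - c a`, which must be injective because `g - c f` is not
      -- surjective.
      refine hx.2 (Subtype.ext (hM.eq_zero (s := -c) (t := 1) (s' := 0) (t' := 1) (by simp) hψ
        ?_ (hM₀ x) ?_))
      · rwa [one_smul, neg_smul, neg_add_eq_sub]
      · rw [← hα, ← hβ, h1]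
        simp
    have hM₁' : Subsingleton M₁ := by
      rw [← Module.finrank_zero_iff (R := k), ← heq, Module.finrank_zero_iff]
      exact hM₀'
    refine subsingleton_of_forall_eq 0 fun m => ?_
    rw [← idem₀_smul_add_idem₁_smul (k := k) m]
    have h0 : idem₀ k • m = 0 := congrArg Subtype.val
      (Subsingleton.elim (⟨idem₀ k • m, m, rfl⟩ : M₀) 0)
    have h1 : idem₁ k • m = 0 := congrArg Subtype.val
      (Subsingleton.elim (⟨idem₁ k • m, m, rfl⟩ : M₁) 0)
    rw [h0, h1, add_zero]

end IsRingelRep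

/-! ### Torsion pairs and `Ext` in module categories -/

/-- The torsion part `t` is the sum of all torsion submodules, and is itself torsion. The preimage
in `M` of the image of a torsion module in `M ⧸ t` is an extension of that image by `t`, so it is
torsion and contained in `t`. -/
theorem isTorsionPair_cogenerated {R : Type u} [Ring R] (P : ObjectProperty (ModuleCat.{v} R)) :
    IsTorsionPair (cogeneratedTorsionClass P) (cogeneratedTorsionfreeClass P) where
  hom_eq_zero _ _ f hX hY := hY f hX
  exists_shortExact M := by
    let t : Submodule R M :=
      sSup {N : Submodule R M | cogeneratedTorsionClass P (ModuleCat.of R N)}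
    have ht : cogeneratedTorsionClass P (ModuleCat.of R t) := by
      intro Y f hY
      have hle : t ≤ (LinearMap.ker f.hom).map t.subtype := by
        refine sSup_le fun N hN x hx => ?_
        have hNt : N ≤ t := le_sSup hN
        refine ⟨⟨x, hNt hx⟩, ?_, rfl⟩
        have h1 := hN (ModuleCat.ofHom (f.hom ∘ₗ Submodule.inclusion hNt)) hY
        exact LinearMap.congr_fun (congrArg ModuleCat.Hom.hom h1) (⟨x, hx⟩ : N)
      ext x
      obtain ⟨y, hy, hyx⟩ := hle x.2
      rw [← Subtype.ext hyx]
      exact hy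
    have hmax (N : Submodule R M) (hN : cogeneratedTorsionClass P (ModuleCat.of R N)) : N ≤ t :=
      le_sSup hN
    refine ⟨ModuleCat.of R t, ModuleCat.of R (M ⧸ t), ModuleCat.ofHom t.subtype,
      ModuleCat.ofHom t.mkQ, ?_, ?_, ht, ?_⟩
    · ext x
      exact (Submodule.Quotient.mk_eq_zero t).mpr x.2
    · have : Mono (ModuleCat.ofHom t.subtype) :=
        (ModuleCat.mono_iff_injective _).mpr t.injective_subtype
      have : Epi (ModuleCat.ofHom t.mkQ) :=
        (ModuleCat.epi_iff_surjective _).mpr t.mkQ_surjective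
      refine ShortComplex.ShortExact.mk ?_
      rw [ShortComplex.moduleCat_exact_iff]
      intro x hx
      exact ⟨⟨x, (Submodule.Quotient.mk_eq_zero t).mp hx⟩, rfl⟩
    · intro X f hX
      let N : Submodule R M := (LinearMap.range f.hom).comap t.mkQ
      have hN : N ≤ t := by
        refine hmax N fun Y p hY => ?_
        have htN : t ≤ N := fun x hx =>
          ⟨0, (map_zero _).trans ((Submodule.Quotient.mk_eq_zero t).mpr hx).symm⟩
        have h1 : p.hom ∘ₗ Submodule.inclusion htN = 0 :=
          congrArg ModuleCat.Hom.hom (ht (ModuleCat.ofHom (p.hom ∘ₗ Submodule.inclusion htN)) hY)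
        let q : N →ₗ[R] LinearMap.range f.hom := t.mkQ.restrict fun x hx => hx
        have hq : Function.Surjective q := by
          rintro ⟨y, hy⟩
          obtain ⟨x, rfl⟩ := t.mkQ_surjective y
          exact ⟨⟨x, hy⟩, rfl⟩
        have hker : LinearMap.ker q ≤ LinearMap.ker p.hom := fun x hx => by
          have hx' : (x : M) ∈ t :=
            (Submodule.Quotient.mk_eq_zero t).mp (congrArg Subtype.val hx)
          exact LinearMap.congr_fun h1 ⟨x, hx'⟩
        let p' : LinearMap.range f.hom →ₗ[R] Y :=
          (LinearMap.ker q).liftQ p.hom hker ∘ₗ (q.quotKerEquivOfSurjective hq).symm.toLinearMap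
        have hp' (x : N) : p' (q x) = p.hom x := by
          have : q x = q.quotKerEquivOfSurjective hq (Submodule.Quotient.mk x) := rfl
          simp only [p', LinearMap.comp_apply, LinearEquiv.coe_coe, this,
            LinearEquiv.symm_apply_apply]
          rfl
        have h2 : p' ∘ₗ f.hom.rangeRestrict = 0 :=
          congrArg ModuleCat.Hom.hom (hX (ModuleCat.ofHom (p' ∘ₗ f.hom.rangeRestrict)) hY)
        ext x
        obtain ⟨z, hz⟩ := f.hom.surjective_rangeRestrict (q x)
        change p.hom x = 0
        rw [← hp', ← hz]
        exact LinearMap.congr_fun h2 z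
      ext x
      obtain ⟨y, hy⟩ := t.mkQ_surjective (f.hom x)
      change f.hom x = 0
      rw [← hy]
      exact (Submodule.Quotient.mk_eq_zero t).mpr (hN ⟨x, hy.symm⟩)

theorem cogeneratedTorsionClass_singleton_iff {R : Type u} [Ring R] {B X : ModuleCat.{v} R} :
    cogeneratedTorsionClass (ObjectProperty.singleton B) X ↔ ∀ φ : X →ₗ[R] B, φ = 0 := by
  refine ⟨fun h φ => congrArg ModuleCat.Hom.hom (h (ModuleCat.ofHom φ) ?_), fun h Y f hY => ?_⟩
  · rw [ObjectProperty.singleton_iff]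
  · rw [ObjectProperty.singleton_iff] at hY
    subst hY
    exact ModuleCat.hom_ext (h f.hom)

theorem alphaClass_singleton_iff {R : Type u} [Ring R] {B X : ModuleCat.{v} R} :
    alphaClass (cogeneratedTorsionClass (ObjectProperty.singleton B)) X ↔
      (∀ φ : X →ₗ[R] B, φ = 0) ∧ ∀ (Y : ModuleCat.{v} R) (F : Y →ₗ[R] X),
        (∀ φ : Y →ₗ[R] B, φ = 0) → ∀ φ : LinearMap.ker F →ₗ[R] B, φ = 0 := by
  refine and_congr cogeneratedTorsionClass_singleton_iff
    ⟨fun h Y F hY φ => ?_, fun h Y F hY => ?_⟩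
  · have h1 := cogeneratedTorsionClass_singleton_iff.mp (h (ModuleCat.ofHom F)
      (cogeneratedTorsionClass_singleton_iff.mpr hY))
    let e := (ModuleCat.kernelIsoKer (ModuleCat.ofHom F)).toLinearEquiv
    have h2 := h1 (φ ∘ₗ e.toLinearMap)
    ext x
    simpa using LinearMap.congr_fun h2 (e.symm x)
  · rw [cogeneratedTorsionClass_singleton_iff] at hY ⊢
    intro φ
    let e := (ModuleCat.kernelIsoKer F).toLinearEquiv
    have h2 := h Y F.hom hY (φ ∘ₗ e.symm.toLinearMap)
    ext x
    simpa using LinearMap.congr_fun h2 (e x)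

theorem subsingleton_ext_zero_iff {R : Type u} [Ring R] [Small.{v} R] {X B : ModuleCat.{v} R} :
    Subsingleton (Abelian.Ext X B 0) ↔ ∀ φ : X →ₗ[R] B, φ = 0 := by
  rw [Abelian.Ext.homEquiv₀.subsingleton_congr]
  refine ⟨fun h φ => congrArg ModuleCat.Hom.hom
    (Subsingleton.elim (ModuleCat.ofHom φ) (0 : X ⟶ B)), fun h =>
      subsingleton_of_forall_eq 0 fun f => ModuleCat.hom_ext (h f.hom)⟩

theorem leftPerpendicular_singleton_iff {R : Type u} [Ring R] [Small.{v} R]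
    {X B : ModuleCat.{v} R} :
    leftPerpendicular (ObjectProperty.singleton B) X ↔
      (∀ φ : X →ₗ[R] B, φ = 0) ∧ Subsingleton (Abelian.Ext X B 1) := by
  rw [← subsingleton_ext_zero_iff]
  refine ⟨fun h => h (by rw [ObjectProperty.singleton_iff]), fun h Y hY => ?_⟩
  rw [ObjectProperty.singleton_iff] at hY
  subst hY
  exact h

/-- If `Ext¹ (X, B) = 0`, then homomorphisms to `B` extend along injections with cokernel `X`. -/
theorem exists_extend_of_subsingleton_ext {R : Type u} [Ring R] [Small.{v} R]
    {X B : ModuleCat.{v} R} (h : Subsingleton (Abelian.Ext X B 1)) {K E : Type v}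
    [AddCommGroup K] [Module R K] [AddCommGroup E] [Module R E] (i : K →ₗ[R] E) (p : E →ₗ[R] X)
    (hi : Function.Injective i) (hp : Function.Surjective p) (hip : Function.Exact i p)
    (φ : K →ₗ[R] B) : ∃ ψ : E →ₗ[R] B, ψ ∘ₗ i = φ := by
  let S := ShortComplex.mk (ModuleCat.ofHom i) (ModuleCat.ofHom p)
    (ModuleCat.hom_ext hip.linearMap_comp_eq_zero)
  have : Mono S.f := (ModuleCat.mono_iff_injective _).mpr hi
  have : Epi S.g := (ModuleCat.epi_iff_surjective _).mpr hp
  have hS : S.ShortExact := .mk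
    (ShortComplex.ShortExact.moduleCat_exact_iff_function_exact S |>.mpr hip)
  obtain ⟨x, hx⟩ := Abelian.Ext.contravariant_sequence_exact₁ hS B
    (Abelian.Ext.mk₀ (ModuleCat.ofHom φ)) (n₁ := 1) rfl (Subsingleton.elim _ _)
  obtain ⟨ψ, rfl⟩ := Abelian.Ext.homEquiv₀.symm.surjective x
  refine ⟨ψ.hom, ?_⟩
  change (Abelian.Ext.mk₀ S.f).comp (Abelian.Ext.mk₀ ψ) _ = _ at hx
  rw [Abelian.Ext.mk₀_comp_mk₀] at hx
  exact congrArg ModuleCat.Hom.hom (Abelian.Ext.homEquiv₀.symm.injective hx)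

/-- If homomorphisms to `B` extend from the kernels of homomorphisms to `X`, then
`Ext¹ (X, B) = 0`. -/
theorem subsingleton_ext_of_exists_extend {R : Type u} [Ring R] [Small.{v} R]
    {X B : ModuleCat.{v} R}
    (h : ∀ (Y : ModuleCat.{v} R) (F : Y →ₗ[R] X) (φ : LinearMap.ker F →ₗ[R] B),
      ∃ ψ : Y →ₗ[R] B, ∀ y : LinearMap.ker F, ψ y = φ y) :
    Subsingleton (Abelian.Ext X B 1) := by
  have hS := X.shortExact_projectiveShortComplex
  have : Projective X.projectiveShortComplex.X₂ := inferInstance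
  refine subsingleton_of_forall_eq 0 fun x => ?_
  -- Every class in `Ext¹` comes from a map on the kernel of a projective presentation; it vanishes
  -- once that map extends to the projective module.
  obtain ⟨y, rfl⟩ := precomp_extClass_surjective_of_projective_X₂ B hS 0 x
  obtain ⟨φ, rfl⟩ := Abelian.Ext.homEquiv₀.symm.surjective y
  obtain ⟨ψ, hψ⟩ := h X.projectiveShortComplex.X₂ X.projectiveShortComplex.g.hom φ.hom
  have h1 : φ = X.projectiveShortComplex.f ≫ ModuleCat.ofHom ψ :=
    ModuleCat.hom_ext (LinearMap.ext fun y => (hψ y).symm)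
  change hS.extClass.comp (Abelian.Ext.mk₀ φ) (add_comm 1 0) = 0
  rw [h1, ← Abelian.Ext.mk₀_comp_mk₀]
  exact hS.extClass_comp_assoc _

/-! ### Comparison of `α(T)` with the perpendicular category -/

namespace IsRingelRep

variable {k V W : Type u} [Field k] [AddCommGroup V] [Module k V] [AddCommGroup W] [Module k W]
  {I : Set k} {f g : V →ₗ[k] W} {bV : Module.Basis I k V} {bW : Module.Basis (Option I) k W}

/-- A functional on `W` killing the image of `f` (for `p = ∞`) or of `g - c f` (for `p = c`) serves
as the component at the vertex `1`; the component at `0` is then forced. -/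
theorem exists_hom_simpleRegular_ne_zero (h : IsRingelRep f g bV bW) (p : OnePoint k) :
    ∃ φ : ModuleCat.of (KroneckerAlgebra k) (RepSpace f g) ⟶ simpleRegular p, φ ≠ 0 := by
  obtain ⟨φ₀, φ₁, hne, hf, hg⟩ : ∃ (φ₀ : V →ₗ[k] k) (φ₁ : W →ₗ[k] k), φ₁ ≠ 0 ∧
      (∀ v, simpleRegularMapA p (φ₀ v) = φ₁ (f v)) ∧
        ∀ v, simpleRegularMapB p (φ₀ v) = φ₁ (g v) := by
    induction p using OnePoint.rec with
    | infty =>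
      obtain ⟨ψ, hψ, hψ'⟩ := h.exists_functional_f
      exact ⟨ψ ∘ₗ g, ψ, hψ, fun v => (LinearMap.congr_fun hψ' v).symm, fun v => rfl⟩
    | coe c =>
      obtain ⟨ψ, hψ, hψ'⟩ := h.exists_functional_sub c
      refine ⟨ψ ∘ₗ f, ψ, hψ, fun v => rfl, fun v => ?_⟩
      have h1 := LinearMap.congr_fun hψ' v
      simp only [LinearMap.comp_apply, LinearMap.sub_apply, LinearMap.smul_apply, map_sub,
        map_smul, LinearMap.zero_apply, sub_eq_zero] at h1
      exact h1.symm
  let φ : RepSpace f g →ₗ[KroneckerAlgebra k]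
      RepSpace (simpleRegularMapA p) (simpleRegularMapB p) :=
    { toFun m := RepSpace.mk _ _ (φ₀ m.1) (φ₁ m.2)
      map_add' m n := by apply RepSpace.ext' <;> simp
      map_smul' x m := by
        apply RepSpace.ext'
        · simp
        · simp [hf, hg] }
  refine ⟨ModuleCat.ofHom φ, fun h0 => hne (LinearMap.ext fun w => ?_)⟩
  have h1 := LinearMap.congr_fun (congrArg ModuleCat.Hom.hom h0) (RepSpace.mk f g 0 w)
  exact congrArg Prod.snd h1

/-- The composite `φ ∘ i` is a nonzero scalar, so dividing `φ` by it gives a retraction. -/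
theorem exists_retraction (h : IsRingelRep f g bV bW) {E : Type*} [AddCommGroup E]
    [Module (KroneckerAlgebra k) E] (i : RepSpace f g →ₗ[KroneckerAlgebra k] E)
    (φ : E →ₗ[KroneckerAlgebra k] RepSpace f g) (hφ : φ ∘ₗ i ≠ 0) :
    ∃ r : E →ₗ[KroneckerAlgebra k] RepSpace f g, ∀ m, r (i m) = m := by
  obtain ⟨c, hc⟩ := h.endomorphism_eq_smul (φ ∘ₗ i)
  have hc₀ : c ≠ 0 := by
    rintro rfl
    exact hφ (LinearMap.ext fun m => by rw [hc, map_zero, zero_smul, LinearMap.zero_apply])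
  let s : RepSpace f g →ₗ[KroneckerAlgebra k] RepSpace f g :=
    { toFun m := algebraMap k (KroneckerAlgebra k) c⁻¹ • m
      map_add' m n := smul_add _ _ _
      map_smul' x m := by
        rw [← mul_smul, Algebra.commutes, mul_smul]
        rfl }
  refine ⟨s ∘ₗ φ, fun m => ?_⟩
  change algebraMap k (KroneckerAlgebra k) c⁻¹ • (φ ∘ₗ i) m = m
  rw [hc, ← mul_smul, ← map_mul, inv_mul_cancel₀ hc₀, map_one, one_smul]

variable {M : Type u} [AddCommGroup M] [Module k M] [Module (KroneckerAlgebra k) M]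
  [IsScalarTower k (KroneckerAlgebra k) M]

/-- Forwards, the identity of the representation extends to the cocycle extension, which therefore
splits; backwards, the extension property of `CoboundarySurjective` is applied to a projective
presentation. -/
theorem leftPerpendicular_iff :
    leftPerpendicular (ObjectProperty.singleton
        (ModuleCat.of (KroneckerAlgebra k) (RepSpace f g))) (ModuleCat.of (KroneckerAlgebra k) M) ↔
      (∀ φ : M →ₗ[KroneckerAlgebra k] RepSpace f g, φ = 0) ∧
        RepSpace.CoboundarySurjective f g M := by
  rw [leftPerpendicular_singleton_iff]
  refine and_congr_right fun _ => ⟨fun h p q => ?_, fun h => ?_⟩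
  · obtain ⟨r, hr⟩ := exists_extend_of_subsingleton_ext h (CocycleExtension.inl f g p q)
      (CocycleExtension.snd f g p q) (CocycleExtension.inl_injective f g p q)
      (CocycleExtension.snd_surjective f g p q) (CocycleExtension.exact_inl_snd f g p q)
      LinearMap.id
    exact CocycleExtension.exists_coboundary_of_retraction r (LinearMap.congr_fun hr)
  · refine subsingleton_ext_of_exists_extend fun Y F φ => ?_
    let : Module k Y := Module.compHom Y (algebraMap k (KroneckerAlgebra k))
    have : IsScalarTower k (KroneckerAlgebra k) Y :=
      IsScalarTower.of_algebraMap_smul fun _ _ => rfl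
    exact h.exists_extend F φ

theorem alphaClass_iff [Nontrivial W] (h : IsRingelRep f g bV bW) :
    alphaClass (cogeneratedTorsionClass (ObjectProperty.singleton
        (ModuleCat.of (KroneckerAlgebra k) (RepSpace f g)))) (ModuleCat.of (KroneckerAlgebra k) M) ↔
      (∀ φ : M →ₗ[KroneckerAlgebra k] RepSpace f g, φ = 0) ∧
        RepSpace.CoboundarySurjective f g M := by
  rw [alphaClass_singleton_iff]
  refine and_congr_right fun hM => ⟨fun hα p q => ?_, fun hC Y F hY φ => ?_⟩
  · obtain ⟨φ, hφ⟩ : ∃ φ : CocycleExtension f g p q →ₗ[KroneckerAlgebra k] RepSpace f g,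
        φ ≠ 0 := by
      -- Otherwise the extension lies in the torsion class, and `hα` puts there the kernel of its
      -- projection, a copy of the nonzero representation itself.
      by_contra! hE
      let i : LinearMap.ker (CocycleExtension.snd f g p q) →ₗ[KroneckerAlgebra k] RepSpace f g :=
        { toFun m := m.1.1
          map_add' _ _ := rfl
          map_smul' x m := by
            have hm : m.1.2 = 0 := m.2
            apply RepSpace.ext' <;> simp [hm] }
      have hi := hα (ModuleCat.of (KroneckerAlgebra k) (CocycleExtension f g p q))
        (CocycleExtension.snd f g p q) hE i
      obtain ⟨w, hw⟩ := exists_ne (0 : W)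
      exact hw (congrArg Prod.snd (LinearMap.congr_fun hi
        ⟨CocycleExtension.mk f g p q (RepSpace.mk f g 0 w) 0, rfl⟩))
    refine (h.exists_retraction (CocycleExtension.inl f g p q) φ fun h0 => hφ ?_).elim
      CocycleExtension.exists_coboundary_of_retraction
    -- If `φ` vanished on the representation, it would factor through `M`, from which all maps are
    -- zero.
    have hker : LinearMap.ker (CocycleExtension.snd f g p q) ≤ LinearMap.ker φ := by
      rw [(CocycleExtension.exact_inl_snd f g p q).linearMap_ker_eq]
      exact LinearMap.range_le_ker_iff.mpr h0
    let e := (CocycleExtension.snd f g p q).quotKerEquivOfSurjective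
      (CocycleExtension.snd_surjective f g p q)
    have h1 := hM ((LinearMap.ker (CocycleExtension.snd f g p q)).liftQ φ hker ∘ₗ
      e.symm.toLinearMap)
    ext1 m
    have h2 := LinearMap.congr_fun h1 (e (Submodule.Quotient.mk m))
    rw [LinearMap.comp_apply, LinearEquiv.coe_coe, LinearEquiv.symm_apply_apply] at h2
    exact h2
  · let : Module k Y := Module.compHom Y (algebraMap k (KroneckerAlgebra k))
    have : IsScalarTower k (KroneckerAlgebra k) Y :=
      IsScalarTower.of_algebraMap_smul fun _ _ => rfl
    obtain ⟨ψ, hψ⟩ := hC.exists_extend F φ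
    ext1 y
    rw [← hψ, hY ψ]
    rfl

end IsRingelRep

theorem mainTheorem12 {k : Type u} [Field k] [IsAlgClosed k] (I : Set k) (hI : I.Infinite) :
    (∀ p : OnePoint k, ∃ f : ringelModule I ⟶ simpleRegular p, f ≠ 0) ∧
      IsTorsionPair (cogeneratedTorsionClass (ObjectProperty.singleton (ringelModule I)))
        (cogeneratedTorsionfreeClass (ObjectProperty.singleton (ringelModule I))) ∧
      alphaClass (cogeneratedTorsionClass (ObjectProperty.singleton (ringelModule I))) =
        leftPerpendicular (ObjectProperty.singleton (ringelModule I)) ∧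
      ∀ X : ModuleCat.{u} (KroneckerAlgebra k),
        alphaClass (cogeneratedTorsionClass (ObjectProperty.singleton (ringelModule I))) X →
          IsFiniteDimensionalModule X → Limits.IsZero X := by
  obtain ⟨bV, bW, h⟩ := exists_isRingelRep_ringelModule I
  have : Nontrivial (ringelW I) := ⟨bW none, 0, bW.ne_zero none⟩
  refine ⟨h.exists_hom_simpleRegular_ne_zero, isTorsionPair_cogenerated _, ?_, ?_⟩
  · funext X
    let : Module k X := Module.compHom X (algebraMap k (KroneckerAlgebra k))
    have : IsScalarTower k (KroneckerAlgebra k) X :=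
      IsScalarTower.of_algebraMap_smul fun _ _ => rfl
    exact propext ((h.alphaClass_iff (M := X)).trans IsRingelRep.leftPerpendicular_iff.symm)
  · intro X hX hfin
    let : Module k X := Module.compHom X (algebraMap k (KroneckerAlgebra k))
    have : IsScalarTower k (KroneckerAlgebra k) X :=
      IsScalarTower.of_algebraMap_smul fun _ _ => rfl
    have : Module.Finite k X := hfin
    obtain ⟨hM, hC⟩ := (h.alphaClass_iff (M := X)).mp hX
    have := h.subsingleton_of_finite hI hC hM
    exact ModuleCat.isZero_of_subsingleton X
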